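/- Let $I\subset\mathbb R$ be a bounded interval and let $m,n\ge 1$ be integers; $f^k$ denotes the $k$-fold iterate of $f$. Let $f\colon I\to I$ be a continuous bijection, and consider the equation $$\frac{\exp\left(f^{0}(x)\right)+\exp\left(f^{m}(x)\right)+\exp\left(f^{2m}(x)\right)+\dots+\exp\left(f^{(4n-2)m}(x)\right)}{4n-1}=\exp\left(f^{(2n-1)m}(x)\right)\qquad(x\in I).\tag{E}$$ (i) If $m$ is odd or $I$ is neither open nor closed, then $f$ satisfies (E) if and only if $f(x)=x$ for all $x\in I$. (ii) If $m$ is even and $I$ is open or closed, then $f$ satisfies (E) if and only if either $f(x)=x$ for all $x\in I$, or $f$ is of the form $$f(x)=\begin{cases}f_0(x)&\text{for } x\in I,\ x\le a,\\ f_0^{-1}(x)&\text{for } x\in I,\ x>a,\end{cases}\tag{F}$$ where $a$ is an interior point of $I$ and $f_0$ is a continuous and strictly decreasing function on $I\cap(-\infty,a]$ with $\lim_{x\to\inf I}f_0(x)=\sup I$ and $f_0(a)=a$. Here $a$ and $f_0$ are arbitrary: each such pair defines by (F) a continuous bijection of $I$ onto itself. -/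

import Mathlib

open Set Filter Topology

/-- The equation stating that for every `x ∈ I` the exponential quasi-arithmetic mean of the
`4n - 1` points `g⁰(x), g¹(x), …, g⁴ⁿ⁻²(x)`, where `g = f^m`, is attained at the middle one,
`g²ⁿ⁻¹(x)`; here `g^i` is the `i`-fold iterate, so `g^i = f^(m * i)`. It is used for `1 ≤ n`. -/
def SatisfiesExpMeanEq (I : Set ℝ) (m n : ℕ) (f : I → I) : Prop :=
  ∀ x : I,
    (∑ i ∈ Finset.range (4 * n - 1), Real.exp (f^[m * i] x)) / (4 * (n : ℝ) - 1)
      = Real.exp (f^[m * (2 * n - 1)] x)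

/-- The data `(a, f₀)`: `a` is an interior point of `I`, and `f₀` is a continuous, strictly
decreasing function on `I ∩ (-∞, a]` with `f₀(x) → sup I` as `x → inf I` and `f₀(a) = a`.
(Values of `f₀` outside `I ∩ (-∞, a]` play no role.) -/
structure IsGenerator (I : Set ℝ) (a : ℝ) (f₀ : ℝ → ℝ) : Prop where
  mem_interior : a ∈ interior I
  continuousOn : ContinuousOn f₀ (I ∩ Iic a)
  strictAntiOn : StrictAntiOn f₀ (I ∩ Iic a)
  tendsto_sInf : Tendsto f₀ (𝓝[>] (sInf I)) (𝓝 (sSup I))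
  map_self : f₀ a = a

/-- `f(x) = f₀(x)` for `x ≤ a` and `f(x) = f₀⁻¹(x)` for `x > a`, where `f₀⁻¹` is the inverse of
`f₀` restricted to `I ∩ (-∞, a]`. -/
def IsGluedFrom (I : Set ℝ) (a : ℝ) (f₀ : ℝ → ℝ) (f : I → I) : Prop :=
  (∀ x : I, (x : ℝ) ≤ a → (f x : ℝ) = f₀ x) ∧
  (∀ x : I, a < (x : ℝ) → (f x : ℝ) ∈ I ∩ Iic a ∧ f₀ (f x) = x)

/-! Put `g = f^[m]`. By (E), the bounded function `exp` takes at the middle of each `g`-orbit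
segment its mean over that segment. A Liouville argument makes `exp` invariant under `g`, so `f^[m]
= id`; conversely this gives (E) at once. As `f` is strictly monotone, `f ∘ f` is increasing of
finite order, so `f` is an involution. An increasing `f` is then the identity. A decreasing one
needs `m` even, swaps the ends of `I` (so `I` is open or closed), and is determined by its
restriction to the left of its fixed point. -/

/-! ### Liouville property for centered means -/

/-- A bounded function whose value at the middle of each orbit segment of length `2N + 1` is the
mean over that segment does not increase along orbits. -/
theorem apply_map_le_of_centered_mean {α : Type*} {g : α → α} (hg : Function.Surjective g)
    {φ : α → ℝ} {B : ℝ} (hB : ∀ x, |φ x| ≤ B) {N : ℕ} (hN : 1 ≤ N)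
    (h : ∀ x, ∑ i ∈ Finset.range (2 * N + 1), φ (g^[i] x) = (2 * N + 1) * φ (g^[N] x)) (x : α) :
    φ (g x) ≤ φ x := by
  set D : α → ℝ := fun y => φ (g y) - φ y with hD
  have hDmean : ∀ y, ∑ i ∈ Finset.range (2 * N + 1), D (g^[i] y) = (2 * N + 1) * D (g^[N] y) := by
    intro y
    have h1 := h (g y)
    simp only [← Function.iterate_succ_apply, Function.iterate_succ_apply'] at h1
    simp only [hD, Finset.sum_sub_distrib, h1, h y]
    ring
  have hbdd : BddAbove (range D) := by
    refine ⟨2 * B, ?_⟩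
    rintro _ ⟨y, rfl⟩
    have := abs_le.1 (hB (g y))
    have := abs_le.1 (hB y)
    simp only [hD]
    linarith
  set M := sSup (range D) with hM
  have hDM : ∀ y, D y ≤ M := fun y => le_csSup hbdd ⟨y, rfl⟩
  -- Harnack inequality: the terms `M - D` are nonnegative, so the one just after the middle is at
  -- most the whole sum.
  have hstep : ∀ y, M - D (g y) ≤ (2 * N + 1) * (M - D y) := by
    intro y
    obtain ⟨z, rfl⟩ := hg.iterate N y
    have h1 : ∑ i ∈ Finset.range (2 * N + 1), (M - D (g^[i] z))
        = (2 * N + 1) * (M - D (g^[N] z)) := by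
      rw [Finset.sum_sub_distrib, hDmean z]
      simp
      ring
    rw [← h1, ← Function.iterate_succ_apply' g N z]
    exact Finset.single_le_sum (f := fun i => M - D (g^[i] z))
      (fun i _ => sub_nonneg.2 (hDM _)) (Finset.mem_range.2 (by omega))
  have hiter : ∀ (j : ℕ) (y : α), M - D (g^[j] y) ≤ (2 * N + 1) ^ j * (M - D y) := by
    intro j y
    induction j with
    | zero => simp
    | succ j ih =>
      rw [Function.iterate_succ_apply', pow_succ', mul_assoc]
      exact (hstep _).trans (by gcongr)
  -- If `M > 0`, start so close to the supremum that `D ≥ M / 2` for `L` steps; then `φ` grows by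
  -- more than `2 * B`, which its bound forbids.
  by_contra! hx
  have hMpos : 0 < M := (sub_pos.2 hx).trans_le (hDM x)
  obtain ⟨L, hL⟩ := exists_nat_gt (4 * B / M)
  have hL' : 2 * B < L * (M / 2) := by
    rw [div_lt_iff₀ hMpos] at hL
    linarith
  have hpow : (0 : ℝ) < (2 * N + 1) ^ L := by positivity
  obtain ⟨_, ⟨y, rfl⟩, hy⟩ := exists_lt_of_lt_csSup (s := range D) ⟨D x, x, rfl⟩
    (show M - M / 2 / (2 * N + 1) ^ L < M from sub_lt_self _ (by positivity))
  have hlow : ∀ j ∈ Finset.range L, M / 2 ≤ D (g^[j] y) := by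
    intro j hj
    have h1 : (2 * N + 1 : ℝ) ^ j * (M - D y) ≤ (2 * N + 1) ^ L * (M / 2 / (2 * N + 1) ^ L) := by
      have h2 : (2 * N + 1 : ℝ) ^ j ≤ (2 * N + 1) ^ L :=
        pow_le_pow_right₀ (by linarith [Nat.cast_nonneg (α := ℝ) N]) (Finset.mem_range.1 hj).le
      exact mul_le_mul h2 (by linarith) (sub_nonneg.2 (hDM y)) hpow.le
    rw [mul_div_cancel₀ _ hpow.ne'] at h1
    linarith [hiter j y]
  have hsum := Finset.card_nsmul_le_sum _ _ _ hlow
  have htel : ∑ j ∈ Finset.range L, D (g^[j] y) = φ (g^[L] y) - φ y := by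
    have := Finset.sum_range_sub (fun j => φ (g^[j] y)) L
    simpa only [Function.iterate_succ_apply', Function.iterate_zero_apply] using this
  rw [htel, Finset.card_range, nsmul_eq_mul] at hsum
  have := abs_le.1 (hB (g^[L] y))
  have := abs_le.1 (hB y)
  linarith

/-- Liouville property: a bounded function satisfying the centered mean equation along the orbits
of a surjection is invariant. -/
theorem apply_map_eq_of_centered_mean {α : Type*} {g : α → α} (hg : Function.Surjective g)
    {φ : α → ℝ} {B : ℝ} (hB : ∀ x, |φ x| ≤ B) {N : ℕ} (hN : 1 ≤ N)
    (h : ∀ x, ∑ i ∈ Finset.range (2 * N + 1), φ (g^[i] x) = (2 * N + 1) * φ (g^[N] x)) (x : α) :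
    φ (g x) = φ x := by
  refine le_antisymm (apply_map_le_of_centered_mean hg hB hN h x) ?_
  have := apply_map_le_of_centered_mean (φ := fun y => -φ y) hg (B := B)
    (fun y => by rw [abs_neg]; exact hB y) hN
    (fun y => by rw [Finset.sum_neg_distrib, h y]; ring) x
  linarith

/-! ### (E) as `f^[m] = id`, and monotone maps of finite order -/

theorem SatisfiesExpMeanEq.iterate_eq_id {I : Set ℝ} (hb : Bornology.IsBounded I) {m n : ℕ}
    (hn : 1 ≤ n) {f : I → I} (hf : Function.Surjective f) (h : SatisfiesExpMeanEq I m n f) :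
    f^[m] = id := by
  obtain ⟨C, hC⟩ := hb.exists_norm_le
  have hB : ∀ x : I, |Real.exp x| ≤ Real.exp C := fun x => by
    rw [abs_of_pos (Real.exp_pos _)]
    exact Real.exp_le_exp.2 ((le_abs_self _).trans (hC x x.2))
  have hcast : ((2 * n - 1 : ℕ) : ℝ) = 2 * n - 1 := by
    rw [Nat.cast_sub (by omega)]
    simp
  have hpos : (4 * (n : ℝ) - 1) ≠ 0 := by
    have : (1 : ℝ) ≤ n := by exact_mod_cast hn
    linarith
  funext x
  have key := apply_map_eq_of_centered_mean (hf.iterate m) (φ := fun x : I => Real.exp x) hB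
    (N := 2 * n - 1) (by omega) (fun x => by
      have h1 := h x
      rw [div_eq_iff hpos] at h1
      simp only [← Function.iterate_mul]
      rw [show 2 * (2 * n - 1) + 1 = 4 * n - 1 by omega, h1, hcast]
      ring) x
  exact Subtype.ext (Real.exp_injective key)

theorem satisfiesExpMeanEq_of_iterate_eq_id {I : Set ℝ} {m n : ℕ} (hn : 1 ≤ n) {f : I → I}
    (h : f^[m] = id) : SatisfiesExpMeanEq I m n f := by
  intro x
  have hpos : (4 * (n : ℝ) - 1) ≠ 0 := by
    have : (1 : ℝ) ≤ n := by exact_mod_cast hn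
    linarith
  rw [div_eq_iff hpos]
  simp only [Function.iterate_mul, h, Function.iterate_id, id, Finset.sum_const, Finset.card_range,
    nsmul_eq_mul]
  rw [Nat.cast_sub (by omega)]
  push_cast
  ring

theorem strictMono_or_strictAnti_of_continuous_injective {I : Set ℝ} (hI : I.OrdConnected)
    {f : I → I} (hc : Continuous f) (hf : Function.Injective f) : StrictMono f ∨ StrictAnti f := by
  rcases isEmpty_or_nonempty I with hE | ⟨⟨x⟩⟩
  · exact Or.inl fun x => hE.elim x
  · have : Inhabited I := ⟨x⟩
    exact hc.strictMono_of_inj hf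

theorem StrictMono.eq_of_iterate_eq_id {α : Type*} [LinearOrder α] {f : α → α} (hf : StrictMono f)
    {m : ℕ} (hm : 1 ≤ m) (h : f^[m] = id) (x : α) : f x = x := by
  have := (Function.Commute.id_right (f := f)).iterate_pos_eq_iff_map_eq hf.monotone strictMono_id
    (x := x) (n := m) hm
  exact this.1 (by rw [h, Function.iterate_id])

theorem involutive_of_iterate_eq_id {α : Type*} [LinearOrder α] {f : α → α}
    (hf : StrictMono f ∨ StrictAnti f) {m : ℕ} (hm : 1 ≤ m) (h : f^[m] = id) :
    Function.Involutive f := by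
  have hmono : StrictMono (f ∘ f) := hf.elim (fun h => h.comp h) (fun h => h.comp h)
  refine hmono.eq_of_iterate_eq_id hm ?_
  rw [show f ∘ f = f^[2] from rfl, ← Function.iterate_mul, mul_comm, Function.iterate_mul, h]
  rfl

/-! ### Decreasing maps of an interval -/

/-- A bounded interval with an antitone self-surjection is open or closed. -/
theorem isOpen_or_isClosed_of_antitone_surjective {I : Set ℝ} (hI : I.OrdConnected)
    (hb : Bornology.IsBounded I) {f : I → I} (hf : Antitone f) (hs : Function.Surjective f) :
    IsOpen I ∨ IsClosed I := by
  rcases I.eq_empty_or_nonempty with rfl | hne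
  · exact Or.inl isOpen_empty
  have hlow : ∀ x ∈ I, sInf I ≤ x := fun x hx => csInf_le hb.bddBelow hx
  have hupp : ∀ x ∈ I, x ≤ sSup I := fun x hx => le_csSup hb.bddAbove hx
  have hIcc : sInf I ∈ I → sSup I ∈ I → IsClosed I := fun hp hq => by
    rw [show I = Icc (sInf I) (sSup I) from
      Subset.antisymm (fun x hx => ⟨hlow x hx, hupp x hx⟩) (hI.out hp hq)]
    exact isClosed_Icc
  by_cases hp : sInf I ∈ I
  · refine Or.inr (hIcc hp ?_)
    -- The image of the least point is the greatest value, so by surjectivity the supremum is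
    -- attained.
    have : sSup I = f ⟨sInf I, hp⟩ := by
      refine le_antisymm (csSup_le hne fun y hy => ?_) (hupp _ (f _).2)
      obtain ⟨x, hx⟩ := hs ⟨y, hy⟩
      have : f x ≤ f ⟨sInf I, hp⟩ := hf (hlow x x.2)
      rw [hx] at this
      exact this
    rw [this]
    exact (f _).2
  by_cases hq : sSup I ∈ I
  · refine Or.inr (hIcc ?_ hq)
    have : sInf I = f ⟨sSup I, hq⟩ := by
      refine le_antisymm (hlow _ (f _).2) (le_csInf hne fun y hy => ?_)
      obtain ⟨x, hx⟩ := hs ⟨y, hy⟩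
      have : f ⟨sSup I, hq⟩ ≤ f x := hf (hupp x x.2)
      rw [hx] at this
      exact this
    rw [this]
    exact (f _).2
  · left
    rw [show I = Ioo (sInf I) (sSup I) from Subset.antisymm
      (fun x hx => ⟨(hlow x hx).lt_of_ne fun h => hp (h ▸ hx),
        (hupp x hx).lt_of_ne fun h => hq (h ▸ hx)⟩)
      fun x hx => by
        obtain ⟨u, hu, hux⟩ := exists_lt_of_csInf_lt hne hx.1
        obtain ⟨v, hv, hxv⟩ := exists_lt_of_lt_csSup hne hx.2
        exact hI.out hu hv ⟨hux.le, hxv.le⟩]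
    exact isOpen_Ioo

/-- `f` swaps `x` and `f x`, so `f - id` changes sign between them. -/
theorem Function.Involutive.exists_fixed_point {I : Set ℝ} (hI : I.OrdConnected)
    (hne : I.Nonempty) {f : I → I} (hc : Continuous f) (hf : Function.Involutive f) :
    ∃ a, f a = a := by
  obtain ⟨x, hx⟩ := hne
  have : PreconnectedSpace I := Subtype.preconnectedSpace hI.isPreconnected
  rcases le_total (f ⟨x, hx⟩) ⟨x, hx⟩ with h | h
  · exact intermediate_value_univ₂ (a := ⟨x, hx⟩) (b := f ⟨x, hx⟩) hc continuous_id h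
      (by rw [hf]; exact h)
  · exact intermediate_value_univ₂ (a := f ⟨x, hx⟩) (b := ⟨x, hx⟩) hc continuous_id
      (by rw [hf]; exact h) h

theorem exists_generator_of_involutive_strictAnti {I : Set ℝ} (hI : I.OrdConnected)
    (hb : Bornology.IsBounded I) {f : I → I} (hc : Continuous f) (hinv : Function.Involutive f)
    (hanti : StrictAnti f) {b : I} (hfb : f b ≠ b) :
    ∃ (a : ℝ) (f₀ : ℝ → ℝ), IsGenerator I a f₀ ∧ IsGluedFrom I a f₀ f := by
  classical
  obtain ⟨⟨a, ha⟩, hfa⟩ := hinv.exists_fixed_point hI ⟨b, b.2⟩ hc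
  have hlow : ∀ x ∈ I, sInf I ≤ x := fun x hx => csInf_le hb.bddBelow hx
  have hupp : ∀ x ∈ I, x ≤ sSup I := fun x hx => le_csSup hb.bddAbove hx
  -- A non-fixed point and its image lie on opposite sides of `a`, which makes `a` interior.
  obtain ⟨u, v, hu, hv⟩ : ∃ u v : I, (u : ℝ) < a ∧ a < v := by
    have hne : b ≠ ⟨a, ha⟩ := fun h => hfb (by rw [h, hfa])
    rcases lt_or_gt_of_ne hne with h | h
    · exact ⟨b, f b, h, by have := hanti h; rwa [hfa] at this⟩
    · exact ⟨f b, b, by have := hanti h; rwa [hfa] at this, h⟩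
  -- The default `sSup I` keeps the limit at `sInf I` valid even off `I`.
  set f₀ : ℝ → ℝ := fun x => if h : x ∈ I then f ⟨x, h⟩ else sSup I with hf₀
  have hval : ∀ x : I, f₀ x = f x := fun x => by simp [hf₀]
  refine ⟨a, f₀, ⟨?_, ?_, ?_, ?_, ?_⟩, fun x _ => (hval x).symm, fun x hx => ⟨⟨(f x).2, ?_⟩, ?_⟩⟩
  · rw [mem_interior_iff_mem_nhds]
    exact mem_of_superset (Ioo_mem_nhds hu hv)
      (Ioo_subset_Icc_self.trans (hI.out u.2 v.2))
  · refine ContinuousOn.mono ?_ inter_subset_left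
    rw [continuousOn_iff_continuous_domRestrict]
    have : I.domRestrict f₀ = fun x => (f x : ℝ) := funext hval
    rw [this]
    exact continuous_subtype_val.comp hc
  · intro x hx y hy hxy
    have := hanti (show (⟨x, hx.1⟩ : I) < ⟨y, hy.1⟩ from hxy)
    rw [hval ⟨x, hx.1⟩, hval ⟨y, hy.1⟩]
    exact this
  · have hub : ∀ x, f₀ x ≤ sSup I := fun x => by
      by_cases h : x ∈ I
      · rw [hval ⟨x, h⟩]
        exact hupp _ (f _).2
      · simp [hf₀, h]
    refine tendsto_order.2 ⟨fun c hc => ?_, fun c hc => Eventually.of_forall fun x =>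
      (hub x).trans_lt hc⟩
    -- For `x` in `I` below `f d`, `f x > f (f d) = d > c`.
    obtain ⟨d, hd, hdq⟩ := exists_between (max_lt hc (hv.trans_le (hupp v v.2)))
    obtain ⟨w, hw, hdw⟩ := exists_lt_of_lt_csSup ⟨a, ha⟩ hdq
    have hdI : d ∈ I := hI.out ha hw ⟨((le_max_right _ _).trans_lt hd).le, hdw.le⟩
    have hpd : sInf I < f ⟨d, hdI⟩ :=
      (hlow _ (f ⟨w, hw⟩).2).trans_lt (hanti (show (⟨d, hdI⟩ : I) < ⟨w, hw⟩ from hdw))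
    filter_upwards [Ioo_mem_nhdsGT hpd] with x hx
    refine ((le_max_left _ _).trans_lt hd).trans ?_
    by_cases h : x ∈ I
    · rw [hval ⟨x, h⟩]
      have := hanti (show (⟨x, h⟩ : I) < f ⟨d, hdI⟩ from hx.2)
      rwa [hinv] at this
    · simpa [hf₀, h] using hdq
  · rw [hval ⟨a, ha⟩, hfa]
  · have := hanti (show (⟨a, ha⟩ : I) < x from hx)
    rw [hfa] at this
    exact le_of_lt this
  · rw [hval, hinv]

/-! ### From a generator to a bijection -/

theorem IsGenerator.mem {I : Set ℝ} {a : ℝ} {f₀ : ℝ → ℝ} (h : IsGenerator I a f₀) : a ∈ I :=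
  interior_subset h.mem_interior

theorem IsGenerator.le_apply {I : Set ℝ} {a : ℝ} {f₀ : ℝ → ℝ} (h : IsGenerator I a f₀) {x : ℝ}
    (hx : x ∈ I ∩ Iic a) : a ≤ f₀ x := by
  have := h.strictAntiOn.antitoneOn hx ⟨h.mem, self_mem_Iic⟩ hx.2
  rwa [h.map_self] at this

theorem IsGluedFrom.involutive {I : Set ℝ} {a : ℝ} {f₀ : ℝ → ℝ} {f : I → I}
    (hg : IsGenerator I a f₀) (h : IsGluedFrom I a f₀ f) : Function.Involutive f := by
  intro x
  apply Subtype.ext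
  rcases le_or_gt (x : ℝ) a with hx | hx
  · have hxA : (x : ℝ) ∈ I ∩ Iic a := ⟨x.2, hx⟩
    rcases le_or_gt (f x : ℝ) a with hy | hy
    · have hfx : (f x : ℝ) = a := le_antisymm hy (by rw [h.1 x hx]; exact hg.le_apply hxA)
      have hxa : (x : ℝ) = a := hg.strictAntiOn.injOn hxA ⟨hg.mem, self_mem_Iic⟩ (by
        rw [← h.1 x hx, hfx, hg.map_self])
      rw [h.1 _ hy, hfx, hg.map_self, hxa]
    · obtain ⟨h1, h2⟩ := h.2 _ hy
      exact hg.strictAntiOn.injOn h1 hxA (by rw [h2, h.1 x hx])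
  · obtain ⟨h1, h2⟩ := h.2 x hx
    rw [h.1 _ h1.2, h2]

theorem IsGluedFrom.antitone {I : Set ℝ} {a : ℝ} {f₀ : ℝ → ℝ} {f : I → I}
    (hg : IsGenerator I a f₀) (h : IsGluedFrom I a f₀ f) : Antitone f := by
  intro x y hxy
  change (f y : ℝ) ≤ f x
  have hxy' : (x : ℝ) ≤ y := hxy
  rcases le_or_gt (x : ℝ) a with hx | hx
  · have hxA : (x : ℝ) ∈ I ∩ Iic a := ⟨x.2, hx⟩
    rw [h.1 x hx]
    rcases le_or_gt (y : ℝ) a with hy | hy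
    · rw [h.1 y hy]
      exact hg.strictAntiOn.antitoneOn hxA ⟨y.2, hy⟩ hxy'
    · exact (h.2 y hy).1.2.trans (hg.le_apply hxA)
  · obtain ⟨h1, h2⟩ := h.2 x hx
    obtain ⟨h3, h4⟩ := h.2 y (hx.trans_le hxy')
    by_contra! hlt
    have := hg.strictAntiOn h1 h3 hlt
    rw [h2, h4] at this
    exact this.not_ge hxy'

theorem sInf_lt_of_mem_interior {I : Set ℝ} (hb : Bornology.IsBounded I) {a : ℝ}
    (ha : a ∈ interior I) : sInf I < a := by
  obtain ⟨l, hl, hlI⟩ := mem_nhdsLE_iff_exists_Ioc_subset.1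
    (mem_nhdsWithin_of_mem_nhds (mem_interior_iff_mem_nhds.1 ha))
  obtain ⟨z, hz⟩ := exists_between (mem_Iio.1 hl)
  exact (csInf_le hb.bddBelow (hlI ⟨hz.1, hz.2.le⟩)).trans_lt hz.2

theorem lt_sSup_of_mem_interior {I : Set ℝ} (hb : Bornology.IsBounded I) {a : ℝ}
    (ha : a ∈ interior I) : a < sSup I := by
  obtain ⟨l, hl, hlI⟩ := mem_nhdsGE_iff_exists_Ico_subset.1
    (mem_nhdsWithin_of_mem_nhds (mem_interior_iff_mem_nhds.1 ha))
  obtain ⟨z, hz⟩ := exists_between (mem_Ioi.1 hl)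
  exact hz.1.trans_le (le_csSup hb.bddAbove (hlI ⟨hz.1.le, hz.2⟩))

theorem IsGenerator.apply_le_sSup {I : Set ℝ} (hI : I.OrdConnected) (hb : Bornology.IsBounded I)
    {a : ℝ} {f₀ : ℝ → ℝ} (h : IsGenerator I a f₀) {x : ℝ} (hx : x ∈ I ∩ Iic a) :
    f₀ x ≤ sSup I := by
  rcases (csInf_le hb.bddBelow hx.1).eq_or_lt with hp | hp
  · have ha := sInf_lt_of_mem_interior hb h.mem_interior
    have hsub : Ioo (sInf I) a ⊆ I ∩ Iic a := fun z hz =>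
      ⟨hI.out hx.1 h.mem ⟨hp ▸ hz.1.le, hz.2.le⟩, hz.2.le⟩
    have hcont : Tendsto f₀ (𝓝[>] sInf I) (𝓝 (f₀ x)) := by
      have := h.continuousOn x hx
      rw [ContinuousWithinAt, ← hp] at this
      rw [← hp]
      refine this.mono_left (nhdsWithin_le_iff.2 (mem_of_superset (Ioo_mem_nhdsGT ha) hsub))
    exact (tendsto_nhds_unique hcont h.tendsto_sInf).le
  · refine ge_of_tendsto h.tendsto_sInf ?_
    filter_upwards [Ioo_mem_nhdsGT hp] with z hz
    obtain ⟨w, hw, hwz⟩ := exists_lt_of_csInf_lt ⟨x, hx.1⟩ hz.1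
    exact (h.strictAntiOn ⟨hI.out hw hx.1 ⟨hwz.le, hz.2.le⟩, hz.2.le.trans hx.2⟩ hx hz.2).le

theorem IsGenerator.apply_mem {I : Set ℝ} (hI : I.OrdConnected) (hb : Bornology.IsBounded I)
    (hoc : IsOpen I ∨ IsClosed I) {a : ℝ} {f₀ : ℝ → ℝ} (h : IsGenerator I a f₀) {x : ℝ}
    (hx : x ∈ I ∩ Iic a) : f₀ x ∈ I := by
  rcases (h.apply_le_sSup hI hb hx).lt_or_eq with hlt | heq
  · obtain ⟨w, hw, hxw⟩ := exists_lt_of_lt_csSup ⟨a, h.mem⟩ hlt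
    exact hI.out h.mem hw ⟨h.le_apply hx, hxw.le⟩
  -- For open `I`, a point left of `x` would have a value above `sSup I`.
  rcases hoc with ho | hcl
  · have hp := sInf_lt_of_mem_interior hb (ho.interior_eq.symm ▸ hx.1 : x ∈ interior I)
    obtain ⟨w, hw, hwx⟩ := exists_lt_of_csInf_lt ⟨x, hx.1⟩ hp
    have hwA : w ∈ I ∩ Iic a := ⟨hw, hwx.le.trans hx.2⟩
    have := h.strictAntiOn hwA hx hwx
    rw [heq] at this
    exact absurd (h.apply_le_sSup hI hb hwA) this.not_ge
  · rw [heq]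
    exact hcl.csSup_mem ⟨a, h.mem⟩ hb.bddAbove

theorem IsGenerator.exists_apply_eq {I : Set ℝ} (hI : I.OrdConnected)
    (hb : Bornology.IsBounded I) (hoc : IsOpen I ∨ IsClosed I) {a : ℝ} {f₀ : ℝ → ℝ}
    (h : IsGenerator I a f₀) {y : ℝ} (hy : y ∈ I) (hay : a ≤ y) :
    ∃ x ∈ I ∩ Iic a, f₀ x = y := by
  have ha := sInf_lt_of_mem_interior hb h.mem_interior
  have hIoo : ∀ z ∈ Ioo (sInf I) a, z ∈ I := fun z hz => by
    obtain ⟨w, hw, hwz⟩ := exists_lt_of_csInf_lt ⟨a, h.mem⟩ hz.1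
    exact hI.out hw h.mem ⟨hwz.le, hz.2.le⟩
  rcases (le_csSup hb.bddAbove hy).lt_or_eq with hlt | heq
  · obtain ⟨x, hyx, hx⟩ :=
      ((h.tendsto_sInf.eventually (lt_mem_nhds hlt)).and (Ioo_mem_nhdsGT ha)).exists
    have hsub : Icc x a ⊆ I ∩ Iic a := fun z hz => ⟨hI.out (hIoo x hx) h.mem hz, hz.2⟩
    obtain ⟨z, hz, hzy⟩ := intermediate_value_Icc' hx.2.le (h.continuousOn.mono hsub)
      (show y ∈ Icc (f₀ a) (f₀ x) from ⟨by rwa [h.map_self], hyx.le⟩)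
    exact ⟨z, hsub hz, hzy⟩
  -- The value `sSup I` needs a preimage only when `I` is closed; `sInf I` serves.
  rcases hoc with ho | hcl
  · exact absurd heq (lt_sSup_of_mem_interior hb (ho.interior_eq.symm ▸ hy : y ∈ interior I)).ne
  · have hp : sInf I ∈ I ∩ Iic a := ⟨hcl.csInf_mem ⟨a, h.mem⟩ hb.bddBelow, ha.le⟩
    refine ⟨sInf I, hp, le_antisymm (heq ▸ h.apply_le_sSup hI hb hp) ?_⟩
    rw [heq]
    refine le_of_tendsto h.tendsto_sInf ?_
    filter_upwards [Ioo_mem_nhdsGT ha] with z hz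
    exact (h.strictAntiOn hp ⟨hIoo z hz, hz.2.le⟩ hz.1).le

theorem IsGenerator.exists_glued {I : Set ℝ} (hI : I.OrdConnected) (hb : Bornology.IsBounded I)
    (hoc : IsOpen I ∨ IsClosed I) {a : ℝ} {f₀ : ℝ → ℝ} (h : IsGenerator I a f₀) :
    ∃ f : I → I, Continuous f ∧ Function.Bijective f ∧ IsGluedFrom I a f₀ f := by
  have hex : ∀ x : I, ∃ y : I, ((x : ℝ) ≤ a → (y : ℝ) = f₀ x) ∧
      (a < (x : ℝ) → (y : ℝ) ∈ I ∩ Iic a ∧ f₀ y = x) := by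
    intro x
    rcases le_or_gt (x : ℝ) a with hx | hx
    · exact ⟨⟨f₀ x, h.apply_mem hI hb hoc ⟨x.2, hx⟩⟩, fun _ => rfl, fun hx' => absurd hx hx'.not_ge⟩
    · obtain ⟨y, hy, hyx⟩ := h.exists_apply_eq hI hb hoc x.2 hx.le
      exact ⟨⟨y, hy.1⟩, fun hx' => absurd hx' hx.not_ge, fun _ => ⟨hy, hyx⟩⟩
  choose f hf using hex
  have hglue : IsGluedFrom I a f₀ f := ⟨fun x => (hf x).1, fun x => (hf x).2⟩
  have hinv := hglue.involutive h
  refine ⟨f, ?_, hinv.bijective, hglue⟩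
  -- A monotone surjection is continuous, so no gluing at `a` is needed.
  have hmono : Monotone (OrderDual.toDual ∘ f) := fun x y hxy => hglue.antitone h hxy
  exact hmono.continuous_of_surjective (OrderDual.toDual.surjective.comp hinv.surjective)

theorem mainTheorem8 (I : Set ℝ) (hI : I.OrdConnected) (hb : Bornology.IsBounded I)
    (m n : ℕ) (hm : 1 ≤ m) (hn : 1 ≤ n) :
    ((Odd m ∨ ¬ (IsOpen I ∨ IsClosed I)) →
      ∀ f : I → I, Continuous f → Function.Bijective f →
        (SatisfiesExpMeanEq I m n f ↔ ∀ x : I, f x = x)) ∧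
    ((Even m ∧ (IsOpen I ∨ IsClosed I)) →
      (∀ f : I → I, Continuous f → Function.Bijective f →
        (SatisfiesExpMeanEq I m n f ↔
          (∀ x : I, f x = x) ∨
            ∃ (a : ℝ) (f₀ : ℝ → ℝ), IsGenerator I a f₀ ∧ IsGluedFrom I a f₀ f)) ∧
      (∀ (a : ℝ) (f₀ : ℝ → ℝ), IsGenerator I a f₀ →
        ∃ f : I → I, Continuous f ∧ Function.Bijective f ∧ IsGluedFrom I a f₀ f)) := by
  have hid : ∀ f : I → I, (∀ x, f x = x) → SatisfiesExpMeanEq I m n f := fun f hf =>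
    satisfiesExpMeanEq_of_iterate_eq_id hn (by rw [show f = id from funext hf, Function.iterate_id])
  refine ⟨fun hcase f hc hf => ⟨fun hE => ?_, hid f⟩, fun ⟨hme, hoc⟩ =>
    ⟨fun f hc hf => ⟨fun hE => ?_, ?_⟩, fun a f₀ hg => hg.exists_glued hI hb hoc⟩⟩
  · have hfm := hE.iterate_eq_id hb hn hf.surjective
    have hmon := strictMono_or_strictAnti_of_continuous_injective hI hc hf.injective
    rcases hcase with hodd | hoc
    · rw [(involutive_of_iterate_eq_id hmon hm hfm).iterate_odd hodd] at hfm
      exact congrFun hfm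
    · rcases hmon with h | h
      · exact h.eq_of_iterate_eq_id hm hfm
      · exact absurd (isOpen_or_isClosed_of_antitone_surjective hI hb h.antitone hf.surjective) hoc
  · have hfm := hE.iterate_eq_id hb hn hf.surjective
    have hmon := strictMono_or_strictAnti_of_continuous_injective hI hc hf.injective
    have hinv := involutive_of_iterate_eq_id hmon hm hfm
    rcases hmon with h | h
    · exact Or.inl (h.eq_of_iterate_eq_id hm hfm)
    · by_cases hall : ∀ x, f x = x
      · exact Or.inl hall
      · push Not at hall
        obtain ⟨b, hfb⟩ := hall
        exact Or.inr (exists_generator_of_involutive_strictAnti hI hb hc hinv h hfb)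
  · rintro (hall | ⟨a, f₀, hg, hglue⟩)
    · exact hid f hall
    · exact satisfiesExpMeanEq_of_iterate_eq_id hn ((hglue.involutive hg).iterate_even hme)
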